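/- For a polynomial $P(z)=\sum_{i=0}^n p_i z^i\in\mathbb{C}[z]$ put $\|P\|=\max_{0\le i\le n}|p_i|$. For nonconstant polynomials $A,B\in\mathbb{C}[z]$ put $$\delta(A,B)=\min\{|A(z)|+|B(z)| : z\in\mathbb{C},\ A(z)=0\text{ or }B(z)=0\}.$$ **Theorem.** For all integers $N,K\ge 1$ and every real $M>0$ there is a constant $C=C(N,K,M)>0$ with the following property. Let $A,B\in\mathbb{C}[z]$ be polynomials of degrees $\deg A=N$ and $\deg B=K$ such that $\|A\|\le 1$ and $\|B\|\le 1$, all complex roots of $A$ and of $B$ have modulus at most $M$, and $\delta(A,B)>0$. Then there is exactly one pair $(R,S)$ of complex polynomials with $\deg R\le K-1$, $\deg S\le N-1$ (the zero polynomial being allowed) and $A(z)R(z)+B(z)S(z)=1$ for all $z\in\mathbb{C}$, and this pair satisfies $$\|R\|\le\frac{C}{\delta(A,B)^2}\quad\text{and}\quad \|S\|\le\frac{C}{\delta(A,B)^2}.$$ -/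

import Mathlib

open Polynomial

noncomputable section

/-- The separation constant `δ(A, B) = min {|A(z)| + |B(z)| : A(z) = 0 or B(z) = 0}`.
The infimum is a minimum if `A` and `B` are nonconstant, see `sepConst_isLeast`. -/
def sepConst (A B : ℂ[X]) : ℝ :=
  sInf {x : ℝ | ∃ z : ℂ, (A.eval z = 0 ∨ B.eval z = 0) ∧ x = ‖A.eval z‖ + ‖B.eval z‖}

/-- `(R, S)` is a minimal solution of the Bézout identity `A R + B S = 1`, that is,
`deg R ≤ deg B - 1` and `deg S ≤ deg A - 1` (the zero polynomial is allowed). -/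
structure IsMinimalBezout (A B R S : ℂ[X]) : Prop where
  degree_left : R.degree < (B.natDegree : WithBot ℕ)
  degree_right : S.degree < (A.natDegree : WithBot ℕ)
  bezout : A * R + B * S = 1

/-- For nonconstant polynomials the infimum that defines `sepConst` is attained. -/
theorem sepConst_isLeast (A B : ℂ[X]) (hA : 1 ≤ A.natDegree) (hB : 1 ≤ B.natDegree) :
    IsLeast {x : ℝ | ∃ z : ℂ, (A.eval z = 0 ∨ B.eval z = 0) ∧ x = ‖A.eval z‖ + ‖B.eval z‖}
      (sepConst A B) := by
  have hA0 : A ≠ 0 := by rintro rfl; simp at hA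
  have hB0 : B ≠ 0 := by rintro rfl; simp at hB
  set T : Set ℝ :=
    {x : ℝ | ∃ z : ℂ, (A.eval z = 0 ∨ B.eval z = 0) ∧ x = ‖A.eval z‖ + ‖B.eval z‖} with hT
  have hfin : T.Finite := by
    refine (((A * B).roots.toFinset.finite_toSet).image
      (fun z : ℂ => ‖A.eval z‖ + ‖B.eval z‖)).subset ?_
    rintro x ⟨z, hz, rfl⟩
    refine ⟨z, ?_, rfl⟩
    simpa [hA0, hB0] using hz
  have hne : T.Nonempty := by
    obtain ⟨z, hz⟩ := IsAlgClosed.exists_root A (natDegree_pos_iff_degree_pos.mp hA).ne'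
    exact ⟨_, z, Or.inl hz, rfl⟩
  exact ⟨hne.csInf_mem hfin, fun x hx => csInf_le hfin.bddBelow hx⟩

end

/-! For monic products, suppose `1/α` bounds `B` below at the roots of `A`, and `1/β` bounds `A`
below at the roots of `B`. Induction on the number of roots bounds the Bézout coefficients by a
constant times `αβ` (`exists_bezout_prod_X_sub_C`). Let `(a, b)` be a farthest pair and `d = |a -
b|`. Deleting `b` from `B` costs at most a factor `d` in `α`, deleting `a` from `A` at most `d` in
`β`; combining the two smaller identities divides by `a - b`, so `d` cancels and no power of it
accumulates. With leading coefficients `u`, `v` of `A`, `B`, one has `αβ = |u||v|/δ²`, whence the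
exponent 2. -/

theorem norm_eval_prod_X_sub_C_le {D : ℝ} (hD : 0 ≤ D) (x : ℂ) (t : Multiset ℂ)
    (h : ∀ y ∈ t, ‖x - y‖ ≤ D) :
    ‖((t.map fun y => X - C y).prod).eval x‖ ≤ D ^ t.card := by
  induction t using Multiset.induction_on with
  | empty => simp
  | cons b t ih =>
    simp only [Multiset.map_cons, Multiset.prod_cons, eval_mul, eval_sub, eval_X, eval_C,
      norm_mul, Multiset.card_cons, pow_succ']
    exact mul_le_mul (h b (Multiset.mem_cons_self b t))
      (ih fun y hy => h y (Multiset.mem_cons_of_mem hy)) (norm_nonneg _) hD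

theorem exists_farthest_pair {s t : Multiset ℂ} (hs : s ≠ 0) (ht : t ≠ 0) :
    ∃ a ∈ s, ∃ b ∈ t, ∀ x ∈ s, ∀ y ∈ t, ‖x - y‖ ≤ ‖a - b‖ := by
  classical
  obtain ⟨a₀, ha₀⟩ := Multiset.exists_mem_of_ne_zero hs
  obtain ⟨b₀, hb₀⟩ := Multiset.exists_mem_of_ne_zero ht
  obtain ⟨p, hp, hmax⟩ := (s.toFinset ×ˢ t.toFinset).exists_max_image
    (fun p => ‖p.1 - p.2‖) ⟨(a₀, b₀), by simp [ha₀, hb₀]⟩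
  simp only [Finset.mem_product, Multiset.mem_toFinset] at hp
  exact ⟨p.1, hp.1, p.2, hp.2, fun x hx y hy => hmax (x, y) (by simp [hx, hy])⟩

theorem norm_coeff_mul_X_sub_C_le {P : ℂ[X]} {b : ℂ} {D E : ℝ} (hb : ‖b‖ ≤ D) (hE : 0 ≤ E)
    (hP : ∀ i, ‖P.coeff i‖ ≤ E) (i : ℕ) : ‖(P * (X - C b)).coeff i‖ ≤ E * (1 + D) := by
  have key : ∀ j, ‖P.coeff j * b‖ ≤ E * D := fun j => by
    rw [norm_mul]; exact mul_le_mul (hP j) hb (norm_nonneg _) hE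
  rcases i with _ | i
  · have h := key 0
    simp only [mul_coeff_zero, coeff_sub, coeff_X_zero, coeff_C_zero, zero_sub, mul_neg, norm_neg]
    linarith
  · rw [coeff_mul_X_sub_C]
    have h1 := norm_sub_le (P.coeff i) (P.coeff (i + 1) * b)
    have h2 := key (i + 1)
    have h3 := hP i
    linarith

theorem degree_mul_X_sub_C_lt {P : ℂ[X]} {b : ℂ} {n : ℕ} (hP : P.degree < (n : WithBot ℕ)) :
    (P * (X - C b)).degree < ((n + 1 : ℕ) : WithBot ℕ) := by
  rw [degree_lt_iff_coeff_zero] at hP ⊢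
  intro m hm
  obtain ⟨k, rfl⟩ : ∃ k, m = k + 1 := ⟨m - 1, by omega⟩
  rw [coeff_mul_X_sub_C, hP k (by omega), hP (k + 1) (by omega)]
  simp

/-- The Bézout coefficients of two monic polynomials, given by their multisets of roots, obtained
by removing the two ends of a farthest pair of roots `(a, b)` in turn, through the identity
`1 / ((z - a) (z - b)) = (1 / (z - a) - 1 / (z - b)) / (a - b)`. -/
theorem exists_bezout_prod_X_sub_C {D : ℝ} (hD : 1 ≤ D) (n : ℕ) :
    ∀ (s t : Multiset ℂ) (α β : ℝ), s.card + t.card = n → (s ≠ 0 ∨ t ≠ 0) →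
      (∀ x ∈ s, ‖x‖ ≤ D) → (∀ y ∈ t, ‖y‖ ≤ D) → (∀ x ∈ s, ∀ y ∈ t, ‖x - y‖ ≤ D) →
      1 ≤ α * D ^ t.card → 1 ≤ β * D ^ s.card →
      (∀ x ∈ s, 1 ≤ α * ‖((t.map fun y => X - C y).prod).eval x‖) →
      (∀ y ∈ t, 1 ≤ β * ‖((s.map fun x => X - C x).prod).eval y‖) →
      ∃ R S : ℂ[X], R.degree < (t.card : WithBot ℕ) ∧ S.degree < (s.card : WithBot ℕ) ∧
        (s.map fun x => X - C x).prod * R + (t.map fun y => X - C y).prod * S = 1 ∧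
        (∀ i, ‖R.coeff i‖ ≤ (D + 2) ^ n * (α * β)) ∧
        ∀ i, ‖S.coeff i‖ ≤ (D + 2) ^ n * (α * β) := by
  have hD0 : 0 < D := by linarith
  induction n with
  | zero =>
    intro s t α β hn h0
    exfalso
    rcases h0 with h | h <;> · have := Multiset.card_pos.2 h; omega
  | succ n ih =>
    intro s t α β hn h0 hs ht hst hα1 hβ1 hα hβ
    have hαpos : 0 < α := pos_of_mul_pos_left (by linarith) (by positivity : 0 ≤ D ^ t.card)
    have hβpos : 0 < β := pos_of_mul_pos_left (by linarith) (by positivity : 0 ≤ D ^ s.card)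
    -- This bounds the trivial solutions `(0, 1)` and `(1, 0)`. The conditions at the roots are
    -- vacuous for an empty multiset, so the separate lower bounds on `α` and `β` are needed here.
    have hone : 1 ≤ (D + 2) ^ (n + 1) * (α * β) := by
      calc (1 : ℝ) ≤ (α * D ^ t.card) * (β * D ^ s.card) := one_le_mul_of_one_le_of_one_le hα1 hβ1
        _ = D ^ (n + 1) * (α * β) := by rw [← hn, pow_add]; ring
        _ ≤ _ := by gcongr; linarith
    have hbd1 : ∀ i, ‖(1 : ℂ[X]).coeff i‖ ≤ (D + 2) ^ (n + 1) * (α * β) := fun i => by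
      rw [coeff_one]
      split_ifs
      · simpa using hone
      · simpa using zero_le_one.trans hone
    have hbd0 : ∀ i, ‖(0 : ℂ[X]).coeff i‖ ≤ (D + 2) ^ (n + 1) * (α * β) := fun i => by
      simpa using zero_le_one.trans hone
    rcases eq_or_ne t 0 with rfl | ht0
    · have hs0 : s ≠ 0 := by simpa using h0
      refine ⟨0, 1, by simp, ?_, by simp, hbd0, hbd1⟩
      rw [degree_one]
      exact_mod_cast Multiset.card_pos.2 hs0
    rcases eq_or_ne s 0 with rfl | hs0
    · refine ⟨1, 0, ?_, by simp, by simp, hbd1, hbd0⟩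
      rw [degree_one]
      exact_mod_cast Multiset.card_pos.2 ht0
    obtain ⟨a, ha, b, hb, hmax⟩ := exists_farthest_pair hs0 ht0
    have hda := hα a ha
    obtain ⟨s', rfl⟩ := Multiset.exists_cons_of_mem ha
    obtain ⟨t', rfl⟩ := Multiset.exists_cons_of_mem hb
    have hs' : ∀ x ∈ s', x ∈ a ::ₘ s' := fun x hx => Multiset.mem_cons_of_mem hx
    have ht' : ∀ y ∈ t', y ∈ b ::ₘ t' := fun y hy => Multiset.mem_cons_of_mem hy
    set A' := (s'.map fun x => X - C x).prod with hA'
    set B' := (t'.map fun y => X - C y).prod with hB'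
    have hA : ((a ::ₘ s').map fun x => X - C x).prod = (X - C a) * A' := by simp [hA']
    have hB : ((b ::ₘ t').map fun y => X - C y).prod = (X - C b) * B' := by simp [hB']
    set d := ‖a - b‖ with hd
    -- Maximality of `d` gives `|x - b| ≤ d` at every root `x` of `A`.
    have hαd : ∀ x ∈ a ::ₘ s', 1 ≤ α * d * ‖B'.eval x‖ := fun x hx => by
      refine (hα x hx).trans ?_
      rw [hB, eval_mul, norm_mul, ← mul_assoc]
      gcongr
      simpa using hmax x hx b hb
    have hβd : ∀ y ∈ b ::ₘ t', 1 ≤ β * d * ‖A'.eval y‖ := fun y hy => by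
      refine (hβ y hy).trans ?_
      rw [hA, eval_mul, norm_mul, ← mul_assoc]
      gcongr
      simpa [norm_sub_rev y a] using hmax a ha y hy
    have hd0 : 0 < d := by
      refine (norm_nonneg _).lt_of_ne fun h => ?_
      have h1 := hαd a ha
      rw [hd, ← h] at h1
      norm_num at h1
    obtain ⟨R₁, S₁, hR₁, hS₁, h₁, bR₁, bS₁⟩ := ih (a ::ₘ s') t' (α * d) β
      (by simp at hn ⊢; omega) (Or.inl (by simp)) hs (fun y hy => ht y (ht' y hy))
      (fun x hx y hy => hst x hx y (ht' y hy))
      ((hαd a ha).trans (by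
        gcongr
        exact norm_eval_prod_X_sub_C_le hD0.le a t' fun y hy => hst a ha y (ht' y hy)))
      hβ1 hαd (fun y hy => hβ y (ht' y hy))
    obtain ⟨R₂, S₂, hR₂, hS₂, h₂, bR₂, bS₂⟩ := ih s' (b ::ₘ t') α (β * d)
      (by simp at hn ⊢; omega) (Or.inr (by simp)) (fun x hx => hs x (hs' x hx)) ht
      (fun x hx y hy => hst x (hs' x hx) y hy) hα1
      ((hβd b hb).trans (by
        gcongr
        exact norm_eval_prod_X_sub_C_le hD0.le b s' fun x hx => by
          rw [norm_sub_rev]; exact hst x (hs' x hx) b hb))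
      (fun x hx => hα x (hs' x hx)) hβd
    rw [hA, ← hB'] at h₁
    rw [hB, ← hA'] at h₂
    set E := (D + 2) ^ n * (α * β * d) with hE
    have hE0 : 0 ≤ E := by positivity
    have e₁ : (D + 2) ^ n * (α * d * β) = E := by rw [hE]; ring
    have e₂ : (D + 2) ^ n * (α * (β * d)) = E := by rw [hE]; ring
    rw [e₁] at bR₁ bS₁
    rw [e₂] at bR₂ bS₂
    have hab : a - b ≠ 0 := norm_pos_iff.1 hd0
    -- Multiplication by a linear factor costs `1 + D`, the other term costs `1`: hence the base `D
    -- + 2`.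
    have hfin : d⁻¹ * (E * (1 + D) + E) = (D + 2) ^ (n + 1) * (α * β) := by
      rw [hE]; field_simp; ring
    refine ⟨C (a - b)⁻¹ * (R₁ * (X - C b) - R₂), C (a - b)⁻¹ * (S₁ - S₂ * (X - C a)),
      ?_, ?_, ?_, fun i => ?_, fun i => ?_⟩
    · rw [degree_C_mul (inv_ne_zero hab)]
      refine (degree_sub_le _ _).trans_lt (max_lt ?_ hR₂)
      rw [Multiset.card_cons]
      exact degree_mul_X_sub_C_lt hR₁
    · rw [degree_C_mul (inv_ne_zero hab)]
      refine (degree_sub_le _ _).trans_lt (max_lt hS₁ ?_)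
      rw [Multiset.card_cons]
      exact degree_mul_X_sub_C_lt hS₂
    · have hc : C (a - b)⁻¹ * (C a - C b) = (1 : ℂ[X]) := by
        rw [← C_sub, ← C_mul, inv_mul_cancel₀ hab, C_1]
      rw [hA, hB]
      linear_combination C (a - b)⁻¹ * (X - C b) * h₁ - C (a - b)⁻¹ * (X - C a) * h₂ + hc
    · rw [coeff_C_mul, norm_mul, norm_inv, ← hd, coeff_sub, ← hfin]
      gcongr
      exact (norm_sub_le _ _).trans
        (add_le_add (norm_coeff_mul_X_sub_C_le (ht b hb) hE0 bR₁ i) (bR₂ i))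
    · rw [coeff_C_mul, norm_mul, norm_inv, ← hd, coeff_sub, ← hfin, add_comm (E * (1 + D))]
      gcongr
      exact (norm_sub_le _ _).trans
        (add_le_add (bS₁ i) (norm_coeff_mul_X_sub_C_le (hs a ha) hE0 bS₂ i))

/-- The Bézout identity itself makes `A` invertible modulo `B`, so `B` divides `R - R'`, which has
smaller degree. -/
theorem IsMinimalBezout.eq {A B R S R' S' : ℂ[X]} (hB : 1 ≤ B.natDegree)
    (h : IsMinimalBezout A B R S) (h' : IsMinimalBezout A B R' S') : R = R' ∧ S = S' := by
  have hB0 : B ≠ 0 := by rintro rfl; simp at hB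
  have hdeg : (R - R').degree < B.degree := by
    rw [degree_eq_natDegree hB0]
    exact (degree_sub_le _ _).trans_lt (max_lt h.degree_left h'.degree_left)
  have hdvd : B ∣ R - R' :=
    ⟨S * (R - R') + R * (S' - S), by
      linear_combination R' * h.bezout - R * h'.bezout⟩
  have hR : R = R' := sub_eq_zero.1 (eq_zero_of_dvd_of_degree_lt hdvd hdeg)
  refine ⟨hR, mul_left_cancel₀ hB0 ?_⟩
  rw [← hR] at h'
  linear_combination h.bezout - h'.bezout

theorem mainTheorem3 (N K : ℕ) (hN : 1 ≤ N) (hK : 1 ≤ K) (M : ℝ) (hM : 0 < M) :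
    ∃ C : ℝ, 0 < C ∧
      ∀ A B : ℂ[X], A.natDegree = N → B.natDegree = K →
        A.supNorm ≤ 1 → B.supNorm ≤ 1 →
        (∀ z : ℂ, A.eval z = 0 → ‖z‖ ≤ M) → (∀ z : ℂ, B.eval z = 0 → ‖z‖ ≤ M) →
        0 < sepConst A B →
          (∃! p : ℂ[X] × ℂ[X], IsMinimalBezout A B p.1 p.2) ∧
          ∀ R S : ℂ[X], IsMinimalBezout A B R S →
            R.supNorm ≤ C / sepConst A B ^ 2 ∧ S.supNorm ≤ C / sepConst A B ^ 2 := by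
  -- `2M + 1` bounds the roots and their mutual distances, and is at least 1.
  have hD : 1 ≤ 2 * M + 1 := by linarith
  refine ⟨(2 * M + 1 + 2) ^ (N + K), by positivity, ?_⟩
  intro A B hAN hBK hA1 hB1 hAM hBM hδ
  have hNA : 1 ≤ A.natDegree := by omega
  have hKB : 1 ≤ B.natDegree := by omega
  have hA0 : A ≠ 0 := by rintro rfl; simp at hNA
  have hB0 : B ≠ 0 := by rintro rfl; simp at hKB
  have hlow := (sepConst_isLeast A B hNA hKB).2
  set δ := sepConst A B with hδdef
  have hsA := IsAlgClosed.splits A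
  have hsB := IsAlgClosed.splits B
  have eA := hsA.eq_prod_roots
  have eB := hsB.eq_prod_roots
  have cA := hsA.natDegree_eq_card_roots
  have cB := hsB.natDegree_eq_card_roots
  set a := A.leadingCoeff with ha
  set b := B.leadingCoeff with hb
  have ha0 : a ≠ 0 := leadingCoeff_ne_zero.2 hA0
  have hb0 : b ≠ 0 := leadingCoeff_ne_zero.2 hB0
  have ha1 : ‖a‖ ≤ 1 := (A.le_supNorm _).trans hA1
  have hb1 : ‖b‖ ≤ 1 := (B.le_supNorm _).trans hB1
  have hrA : ∀ x ∈ A.roots, A.eval x = 0 := fun x hx => (mem_roots hA0).1 hx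
  have hrB : ∀ y ∈ B.roots, B.eval y = 0 := fun y hy => (mem_roots hB0).1 hy
  set s := A.roots with hs
  set t := B.roots with ht
  set A' := (s.map fun x => X - C x).prod with hA'
  set B' := (t.map fun y => X - C y).prod with hB'
  have hα : ∀ x ∈ s, 1 ≤ ‖b‖ / δ * ‖B'.eval x‖ := fun x hx => by
    have h := hlow ⟨x, Or.inl (hrA x hx), rfl⟩
    rw [hrA x hx, norm_zero, zero_add, eB, eval_mul, eval_C, norm_mul] at h
    rw [div_mul_eq_mul_div, one_le_div hδ]
    exact h
  have hβ : ∀ y ∈ t, 1 ≤ ‖a‖ / δ * ‖A'.eval y‖ := fun y hy => by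
    have h := hlow ⟨y, Or.inr (hrB y hy), rfl⟩
    rw [hrB y hy, norm_zero, add_zero, eA, eval_mul, eval_C, norm_mul] at h
    rw [div_mul_eq_mul_div, one_le_div hδ]
    exact h
  have hst : ∀ x ∈ s, ∀ y ∈ t, ‖x - y‖ ≤ 2 * M + 1 := fun x hx y hy => by
    have h1 := norm_sub_le x y
    have h2 := hAM x (hrA x hx)
    have h3 := hBM y (hrB y hy)
    linarith
  obtain ⟨x₀, hx₀⟩ := Multiset.card_pos_iff_exists_mem.1 (by omega : 0 < s.card)
  obtain ⟨y₀, hy₀⟩ := Multiset.card_pos_iff_exists_mem.1 (by omega : 0 < t.card)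
  obtain ⟨R, S, hR, hS, hRS, bR, bS⟩ := exists_bezout_prod_X_sub_C hD (N + K) s t
    (‖b‖ / δ) (‖a‖ / δ) (by omega) (Or.inl (by rintro h; simp [h] at hx₀))
    (fun x hx => (hAM x (hrA x hx)).trans (by linarith))
    (fun y hy => (hBM y (hrB y hy)).trans (by linarith)) hst
    ((hα x₀ hx₀).trans (by
      gcongr
      exact norm_eval_prod_X_sub_C_le (by linarith) x₀ t fun y hy => hst x₀ hx₀ y hy))
    ((hβ y₀ hy₀).trans (by
      gcongr
      exact norm_eval_prod_X_sub_C_le (by linarith) y₀ s fun x hx => by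
        rw [norm_sub_rev]; exact hst x hx y₀ hy₀))
    hα hβ
  have hmin : IsMinimalBezout A B (C a⁻¹ * R) (C b⁻¹ * S) := by
    refine ⟨?_, ?_, ?_⟩
    · rwa [degree_C_mul (inv_ne_zero ha0), cB]
    · rwa [degree_C_mul (inv_ne_zero hb0), cA]
    · have h1 : C a * C a⁻¹ = (1 : ℂ[X]) := by rw [← C_mul, mul_inv_cancel₀ ha0, C_1]
      have h2 : C b * C b⁻¹ = (1 : ℂ[X]) := by rw [← C_mul, mul_inv_cancel₀ hb0, C_1]
      linear_combination (C a⁻¹ * R) * eA + (C b⁻¹ * S) * eB + A' * R * h1 + B' * S * h2 + hRS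
  refine ⟨⟨(C a⁻¹ * R, C b⁻¹ * S), hmin, fun p hp => ?_⟩, fun R₁ S₁ h₁ => ?_⟩
  · exact Prod.ext (hp.eq hKB hmin).1 (hp.eq hKB hmin).2
  · obtain ⟨rfl, rfl⟩ := h₁.eq hKB hmin
    -- Undoing the monic normalization divides by a leading coefficient `u`, possibly tiny; the
    -- factor `|u|` in `αβ` absorbs this.
    have hscale : ∀ {u v : ℂ} {P : ℂ[X]}, u ≠ 0 → ‖v‖ ≤ 1 →
        (∀ i, ‖P.coeff i‖ ≤ (2 * M + 1 + 2) ^ (N + K) * (‖v‖ / δ * (‖u‖ / δ))) →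
        (C u⁻¹ * P).supNorm ≤ (2 * M + 1 + 2) ^ (N + K) / δ ^ 2 := by
      intro u v P hu hv hP
      obtain ⟨i, hi⟩ := (C u⁻¹ * P).exists_eq_supNorm
      have hu' : 0 < ‖u‖ := norm_pos_iff.2 hu
      rw [hi, coeff_C_mul, norm_mul, norm_inv]
      calc ‖u‖⁻¹ * ‖P.coeff i‖
          ≤ ‖u‖⁻¹ * ((2 * M + 1 + 2) ^ (N + K) * (‖v‖ / δ * (‖u‖ / δ))) := by
            gcongr; exact hP i
        _ = (2 * M + 1 + 2) ^ (N + K) / δ ^ 2 * ‖v‖ := by field_simp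
        _ ≤ _ := mul_le_of_le_one_right (by positivity) hv
    exact ⟨hscale ha0 hb1 bR, hscale hb0 ha1 fun i => by rw [mul_comm (‖a‖ / δ)]; exact bS i⟩
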